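/- Let $n\ge 0$ and $m>n$ be integers and let $\mathbb T^n=\mathbb R^n/\mathbb Z^n$. A hyperplane on $\mathbb T^n$ is a set $H=\theta^{-1}(b)$, where $\theta:\mathbb T^n\to S^1=\mathbb R/\mathbb Z$ is a surjective continuous group homomorphism and $b\in S^1$; if $\theta(x)=a_1x_1+\dots+a_nx_n$ with $a=(a_1,\dots,a_n)\in\mathbb Z^n$, then $a$ is called a normal vector of $H$. Let $\mathcal A=\{H_1,\dots,H_m\}$ be an arrangement of $m$ distinct hyperplanes on $\mathbb T^n$ and let $a_i\in\mathbb Z^n$ be a normal vector of $H_i$. Assume that $\mathcal A$ is - in general position: any $k\le n$ distinct hyperplanes of $\mathcal A$ have an intersection that is empty or of dimension at most $n-k$, and any $k>n$ distinct hyperplanes of $\mathcal A$ have empty intersection; and - spanning: some $n$ distinct hyperplanes of $\mathcal A$ have a common point. Let $f_n(\mathcal A)$ be the number of $n$-dimensional flats (regions) of $\mathcal A$, that is, of connected components of $\mathbb T^n\setminus\bigcup_{i=1}^m H_i$. Then $f_n(\mathcal A)$ is finite and $$f_n(\mathcal A)=\sum_{\substack{S=\{i_1<\dots<i_n\}\subseteq\{1,\dots,m\}}}\bigl|\det(a_{i_1}\mid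 a_{i_2}\mid\dots\mid a_{i_n})\bigr|.$$ -/

import Mathlib

/-- An affine toric hyperplane of the `n`-torus `(ℝ/ℤ)ⁿ`: the preimage of a point of the circle
under a surjective continuous group homomorphism. -/
def IsAffineToricHyperplane {n : ℕ} (H : Set (UnitAddTorus (Fin n))) : Prop :=
  ∃ (θ : UnitAddTorus (Fin n) →ₜ+ UnitAddCircle) (b : UnitAddCircle),
    Function.Surjective θ ∧ H = θ ⁻¹' {b}

/-- The integer vector `a` is a normal vector of `H`: the set `H` is the preimage of a point under
a surjective continuous group homomorphism which is `x ↦ a₁ x₁ + ⋯ + aₙ xₙ`. -/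
def IsNormalVector {n : ℕ} (a : Fin n → ℤ) (H : Set (UnitAddTorus (Fin n))) : Prop :=
  ∃ (θ : UnitAddTorus (Fin n) →ₜ+ UnitAddCircle) (b : UnitAddCircle),
    Function.Surjective θ ∧ (∀ x, θ x = ∑ j, a j • x j) ∧ H = θ ⁻¹' {b}

/-- An arrangement of `m` (pairwise distinct, enumerated) affine toric hyperplanes on the
`n`-torus. -/
structure ToricArrangement (n m : ℕ) where
  hyperplane : Fin m → Set (UnitAddTorus (Fin n))
  injective : Function.Injective hyperplane
  isAffineToricHyperplane : ∀ i, IsAffineToricHyperplane (hyperplane i)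

namespace ToricArrangement

/-- General position: any `k ≤ n` of the hyperplanes meet in dimension at most `n - k`, and any
`k > n` of them have empty intersection. An intersection of hyperplanes is empty or a translate of
a closed subgroup, hence a smooth submanifold, so that its dimension is its Hausdorff dimension;
the empty set satisfies the bound (Mathlib has `dimH ∅ = 0`). -/
def InGeneralPosition {n m : ℕ} (A : ToricArrangement n m) : Prop :=
  (∀ S : Finset (Fin m), S.card ≤ n →
    dimH (⋂ i ∈ S, A.hyperplane i) ≤ ((n - S.card : ℕ) : ENNReal)) ∧
  (∀ S : Finset (Fin m), n < S.card → ⋂ i ∈ S, A.hyperplane i = ∅)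

/-- Spanning: some `n` of the hyperplanes have a common point. -/
def IsSpanning {n m : ℕ} (A : ToricArrangement n m) : Prop :=
  ∃ S : Finset (Fin m), S.card = n ∧ (⋂ i ∈ S, A.hyperplane i).Nonempty

/-- The `n`-dimensional flats (regions): the connected components of the complement of the union
of the hyperplanes. -/
abbrev TopFlats {n m : ℕ} (A : ToricArrangement n m) : Type :=
  ConnectedComponents ((⋃ i, A.hyperplane i)ᶜ : Set (UnitAddTorus (Fin n)))

end ToricArrangement

/-- For a set `S` of `n` indices `i₁ < ⋯ < iₙ`, the matrix with columns `a_{i₁}, …, a_{iₙ}`. -/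
def normalMatrix {n m : ℕ} (a : Fin m → Fin n → ℤ) (S : {S : Finset (Fin m) // S.card = n}) :
    Matrix (Fin n) (Fin n) ℤ :=
  Matrix.of fun r c => a (S.1.orderEmbOfFin S.2 c) r

/-! Lift to `ℝⁿ`: the arrangement becomes the periodic family of walls `αᵢ · x - βᵢ ∈ ℤ`, which cuts
space into cells indexed by integer vectors `k`. Fix a generic linear form `c`. The normals span, so
closed cells are compact and `c` has a unique minimizer on each nonempty one; this minimizer is a
vertex, meaning that the normals tight there span (`IsCellMin.span_tightSet`, `IsCellMin.eq`).
Conversely, general position leaves exactly `n` walls through a vertex, and the signs of the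
coordinates of `c` in the basis of their normals single out the one adjacent cell minimized there
(`exists_isCellMin_of_simple`, `IsCellMin.index_eq`). This matching commutes with integer
translations, so regions on the torus correspond to vertices on the torus
(`nonempty_regions_equiv_vertices`).

Each vertex lies on exactly one `n`-subset `S` of hyperplanes. The points common to `S` solve a
square integral system, which has `|det|` solutions when nonsingular (`card_solutions_torus`). If it
is singular, a solution would bring a whole line with it, against the dimension bound, so both the
count and the determinant are zero. -/

open Set Filter Topology Module

/-! ### Linear forms minimized on the cells of an affine arrangement -/

section Cells

variable {ι κ : Type*}

/-- A covector is generic if it lies in no proper subspace spanned by some of the `αᵢ`. -/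
def IsGenericCovector (α : ι → κ → ℝ) (c : κ → ℝ) : Prop :=
  ∀ s : Set ι, c ∈ Submodule.span ℝ (α '' s) → Submodule.span ℝ (α '' s) = ⊤

/-- A real vector space is not a finite union of proper subspaces. -/
lemma exists_isGenericCovector [Finite ι] (α : ι → κ → ℝ) : ∃ c, IsGenericCovector α c := by
  by_contra! h
  let p : {s : Set ι // Submodule.span ℝ (α '' s) ≠ ⊤} → Submodule ℝ (κ → ℝ) :=
    fun s => Submodule.span ℝ (α '' s.1)
  obtain ⟨s, hs⟩ := Subspace.exists_eq_top_of_iUnion_eq_univ (p := p) (by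
    refine eq_univ_of_forall fun c => ?_
    have := h c
    simp only [IsGenericCovector, not_forall] at this
    obtain ⟨s, hc, hs⟩ := this
    exact mem_iUnion.2 ⟨⟨s, hs⟩, hc⟩)
  exact s.2 hs

variable [Fintype κ]

/-- The open cell `{x | kᵢ < αᵢ · x - βᵢ < kᵢ + 1 for all i}`. -/
def openCell (α : ι → κ → ℝ) (β : ι → ℝ) (k : ι → ℤ) : Set (κ → ℝ) :=
  {x | ∀ i, (k i : ℝ) < α i ⬝ᵥ x - β i ∧ α i ⬝ᵥ x - β i < k i + 1}

/-- The closed cell `{x | kᵢ ≤ αᵢ · x - βᵢ ≤ kᵢ + 1 for all i}`. -/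
def closedCell (α : ι → κ → ℝ) (β : ι → ℝ) (k : ι → ℤ) : Set (κ → ℝ) :=
  {x | ∀ i, (k i : ℝ) ≤ α i ⬝ᵥ x - β i ∧ α i ⬝ᵥ x - β i ≤ k i + 1}

/-- The indices `i` for which `v` lies on one of the hyperplanes `αᵢ · x - βᵢ = z`, `z ∈ ℤ`. -/
def tightSet (α : ι → κ → ℝ) (β : ι → ℝ) (v : κ → ℝ) : Set ι :=
  {i | ∃ z : ℤ, α i ⬝ᵥ v - β i = z}

/-- `v` minimizes the linear form `c` on the closed cell `k`. -/
def IsCellMin (α : ι → κ → ℝ) (β : ι → ℝ) (c : κ → ℝ) (k : ι → ℤ) (v : κ → ℝ) : Prop :=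
  v ∈ closedCell α β k ∧ ∀ y ∈ closedCell α β k, c ⬝ᵥ v ≤ c ⬝ᵥ y

lemma openCell_subset_closedCell (α : ι → κ → ℝ) (β : ι → ℝ) (k : ι → ℤ) :
    openCell α β k ⊆ closedCell α β k :=
  fun _ hx i => ⟨(hx i).1.le, (hx i).2.le⟩

lemma mem_openCell_floor {α : ι → κ → ℝ} {β : ι → ℝ} {x : κ → ℝ} (hx : tightSet α β x = ∅) :
    x ∈ openCell α β fun i => ⌊α i ⬝ᵥ x - β i⌋ := by
  intro i
  refine ⟨lt_of_le_of_ne (Int.floor_le _) fun h => ?_, Int.lt_floor_add_one _⟩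
  have : i ∈ tightSet α β x := ⟨_, h.symm⟩
  simp [hx] at this

lemma tightSet_eq_empty_of_mem_openCell {α : ι → κ → ℝ} {β : ι → ℝ} {k : ι → ℤ} {x : κ → ℝ}
    (hx : x ∈ openCell α β k) : tightSet α β x = ∅ := by
  refine eq_empty_of_forall_notMem ?_
  rintro i ⟨z, hz⟩
  have h := hx i
  rw [hz] at h
  have h1 : k i < z := by exact_mod_cast h.1
  have h2 : z < k i + 1 := by exact_mod_cast h.2
  omega

lemma convex_openCell (α : ι → κ → ℝ) (β : ι → ℝ) (k : ι → ℤ) : Convex ℝ (openCell α β k) := by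
  intro x hx y hy s t hs ht hst i
  have hx' := hx i
  have hy' := hy i
  simp only [dotProduct_add, dotProduct_smul, smul_eq_mul]
  obtain rfl : s = 1 - t := by linarith
  rcases eq_or_lt_of_le ht with rfl | ht
  · constructor <;> linarith
  · constructor <;> nlinarith

lemma continuous_dotProduct_left (a : κ → ℝ) : Continuous fun x : κ → ℝ => a ⬝ᵥ x := by
  unfold dotProduct
  fun_prop

lemma isOpen_openCell [Finite ι] (α : ι → κ → ℝ) (β : ι → ℝ) (k : ι → ℤ) :
    IsOpen (openCell α β k) := by
  simp only [openCell, ofPred_forall]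
  refine isOpen_iInter_of_finite fun i => ?_
  have h : Continuous fun x : κ → ℝ => α i ⬝ᵥ x - β i :=
    (continuous_dotProduct_left (α i)).sub continuous_const
  exact (isOpen_lt continuous_const h).inter (isOpen_lt h continuous_const)

lemma isClosed_closedCell (α : ι → κ → ℝ) (β : ι → ℝ) (k : ι → ℤ) :
    IsClosed (closedCell α β k) := by
  simp only [closedCell, ofPred_forall]
  refine isClosed_iInter fun i => ?_
  have h : Continuous fun x : κ → ℝ => α i ⬝ᵥ x - β i :=
    (continuous_dotProduct_left (α i)).sub continuous_const
  exact (isClosed_le continuous_const h).inter (isClosed_le h continuous_const)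

/-- A vector orthogonal to a spanning set vanishes. -/
lemma eq_zero_of_dotProduct_eq_zero_of_span_eq_top {s : Set (κ → ℝ)}
    (hs : Submodule.span ℝ s = ⊤) {w : κ → ℝ} (hw : ∀ a ∈ s, a ⬝ᵥ w = 0) : w = 0 := by
  have h : ∀ x ∈ Submodule.span ℝ s, x ⬝ᵥ w = 0 := by
    intro x hx
    induction hx using Submodule.span_induction with
    | mem x hx => exact hw x hx
    | zero => simp
    | add x y _ _ hx hy => rw [add_dotProduct, hx, hy, add_zero]
    | smul t x _ hx => rw [smul_dotProduct, hx, smul_zero]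
  exact dotProduct_self_eq_zero.1 (h w (hs ▸ Submodule.mem_top))

/-- Since the normals span, `x ↦ (αᵢ · x)ᵢ` is injective, hence antilipschitz, and the cell is the
preimage of a box. -/
lemma isCompact_closedCell [Fintype ι] {α : ι → κ → ℝ}
    (hα : Submodule.span ℝ (range α) = ⊤) (β : ι → ℝ) (k : ι → ℤ) :
    IsCompact (closedCell α β k) := by
  let f : (κ → ℝ) →ₗ[ℝ] (ι → ℝ) := Matrix.mulVecLin (Matrix.of α)
  have hf : LinearMap.ker f = ⊥ := by
    refine (Submodule.eq_bot_iff _).2 fun w hw => ?_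
    refine eq_zero_of_dotProduct_eq_zero_of_span_eq_top hα ?_
    rintro _ ⟨i, rfl⟩
    exact congrFun hw i
  obtain ⟨K, -, hK⟩ := f.exists_antilipschitzWith hf
  refine Metric.isCompact_of_isClosed_isBounded (isClosed_closedCell α β k) ?_
  refine (hK.isBounded_preimage
    (Metric.isBounded_Icc (fun i => k i + β i) (fun i => k i + 1 + β i))).subset ?_
  intro x hx
  have e : ∀ i, f x i = α i ⬝ᵥ x := fun i => rfl
  exact ⟨fun i => by linarith [hx i, e i], fun i => by linarith [hx i, e i]⟩

lemma exists_isCellMin [Fintype ι] {α : ι → κ → ℝ}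
    (hα : Submodule.span ℝ (range α) = ⊤) (β : ι → ℝ) (c : κ → ℝ) {k : ι → ℤ}
    (hk : (openCell α β k).Nonempty) : ∃ v, IsCellMin α β c k v := by
  obtain ⟨v, hv, h⟩ := (isCompact_closedCell hα β k).exists_isMinOn
    (hk.mono (openCell_subset_closedCell α β k)) (continuous_dotProduct_left c).continuousOn
  exact ⟨v, hv, fun y hy => h hy⟩

/-- A feasible direction at a minimizer does not decrease the linear form. -/
lemma IsCellMin.dotProduct_nonneg [Finite ι] {α : ι → κ → ℝ} {β : ι → ℝ} {c v : κ → ℝ}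
    {k : ι → ℤ} (hv : IsCellMin α β c k v) {w : κ → ℝ}
    (h0 : ∀ i, α i ⬝ᵥ v - β i = k i → 0 ≤ α i ⬝ᵥ w)
    (h1 : ∀ i, α i ⬝ᵥ v - β i = k i + 1 → α i ⬝ᵥ w ≤ 0) : 0 ≤ c ⬝ᵥ w := by
  have key : ∀ᶠ ε : ℝ in 𝓝[>] 0, v + ε • w ∈ closedCell α β k := by
    refine eventually_all.2 fun i => ?_
    simp only [dotProduct_add, dotProduct_smul, smul_eq_mul]
    have ht : Tendsto (fun ε : ℝ => α i ⬝ᵥ v + ε * α i ⬝ᵥ w - β i) (𝓝[>] 0)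
        (𝓝 (α i ⬝ᵥ v - β i)) := by
      have : Continuous fun ε : ℝ => α i ⬝ᵥ v + ε * α i ⬝ᵥ w - β i := by fun_prop
      simpa using (this.tendsto 0).mono_left nhdsWithin_le_nhds
    refine Eventually.and ?_ ?_
    · rcases eq_or_lt_of_le (hv.1 i).1 with h | h
      · filter_upwards [self_mem_nhdsWithin] with ε hε
        nlinarith [h0 i h.symm, mem_Ioi.1 hε]
      · exact (ht.eventually (lt_mem_nhds h)).mono fun _ => le_of_lt
    · rcases eq_or_lt_of_le (hv.1 i).2 with h | h
      · filter_upwards [self_mem_nhdsWithin] with ε hε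
        nlinarith [h1 i h, mem_Ioi.1 hε]
      · exact (ht.eventually (gt_mem_nhds h)).mono fun _ => le_of_lt
  obtain ⟨ε, hε, hpos⟩ := (key.and self_mem_nhdsWithin).exists
  have := hv.2 _ hε
  rw [dotProduct_add, dotProduct_smul, smul_eq_mul] at this
  exact nonneg_of_mul_nonneg_right (by linarith) (mem_Ioi.1 hpos)

/-- A covector outside a span is negative on some vector orthogonal to the span. -/
lemma exists_dotProduct_neg_of_notMem_span {s : Set (κ → ℝ)} {c : κ → ℝ}
    (hc : c ∉ Submodule.span ℝ s) : ∃ w, (∀ a ∈ s, a ⬝ᵥ w = 0) ∧ c ⬝ᵥ w < 0 := by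
  classical
  obtain ⟨f, hfc, hf⟩ := Submodule.exists_le_ker_of_notMem hc
  obtain ⟨w, rfl⟩ := (dotProductEquiv ℝ κ).surjective f
  simp only [dotProductEquiv_apply_apply, dotProduct_comm w] at hfc
  have hw : ∀ a ∈ s, a ⬝ᵥ w = 0 := fun a ha => by
    simpa [dotProduct_comm w] using hf (Submodule.subset_span ha)
  rcases lt_or_gt_of_ne hfc with h | h
  · exact ⟨w, hw, h⟩
  · exact ⟨-w, fun a ha => by simp [hw a ha], by simpa using h⟩

/-- If `c` were outside the span of the tight normals, a small move orthogonal to all of them would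
stay in the cell and decrease `c`. So `c` is in the span, and genericity applies. -/
lemma IsCellMin.span_tightSet [Finite ι] {α : ι → κ → ℝ} {β : ι → ℝ} {c v : κ → ℝ}
    {k : ι → ℤ} (hc : IsGenericCovector α c) (hv : IsCellMin α β c k v) :
    Submodule.span ℝ (α '' tightSet α β v) = ⊤ := by
  refine hc _ ?_
  by_contra h
  obtain ⟨w, hw, hneg⟩ := exists_dotProduct_neg_of_notMem_span h
  refine hneg.not_ge (hv.dotProduct_nonneg (fun i hi => ?_) fun i hi => ?_)
  · exact (hw _ (mem_image_of_mem _ ⟨k i, hi⟩)).ge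
  · exact (hw _ (mem_image_of_mem _ ⟨k i + 1, by push_cast; exact hi⟩)).le

/-- The midpoint of two minimizers is a minimizer. A wall tight at the midpoint is an endpoint of
`[kᵢ, kᵢ + 1]`, hence tight at both ends, so `u - v` is orthogonal to a spanning set. -/
lemma IsCellMin.eq [Finite ι] {α : ι → κ → ℝ} {β : ι → ℝ} {c u v : κ → ℝ}
    {k : ι → ℤ} (hc : IsGenericCovector α c) (hu : IsCellMin α β c k u)
    (hv : IsCellMin α β c k v) : u = v := by
  have hw : IsCellMin α β c k ((1 / 2 : ℝ) • (u + v)) := by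
    refine ⟨fun i => ?_, fun y hy => ?_⟩
    · simp only [dotProduct_add, dotProduct_smul, smul_eq_mul]
      constructor <;> linarith [hu.1 i, hv.1 i]
    · simp only [dotProduct_add, dotProduct_smul, smul_eq_mul]
      linarith [hu.2 y hy, hv.2 y hy]
  refine sub_eq_zero.1 (eq_zero_of_dotProduct_eq_zero_of_span_eq_top (hw.span_tightSet hc) ?_)
  rintro _ ⟨i, ⟨z, hz⟩, rfl⟩
  have hk := hw.1 i
  rw [hz] at hk
  have h1 : k i ≤ z := by exact_mod_cast hk.1
  have h2 : z ≤ k i + 1 := by exact_mod_cast hk.2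
  simp only [dotProduct_add, dotProduct_smul, smul_eq_mul] at hz
  rw [dotProduct_sub]
  obtain rfl | rfl : z = k i ∨ z = k i + 1 := by omega
  · linarith [hu.1 i, hv.1 i]
  · push_cast at hz
    linarith [hu.1 i, hv.1 i]

lemma card_le_ncard_of_span_image_eq_top [Finite ι] {α : ι → κ → ℝ} {s : Set ι}
    (hs : Submodule.span ℝ (α '' s) = ⊤) : Fintype.card κ ≤ s.ncard := by
  classical
  have := Fintype.ofFinite ι
  have h := finrank_span_finset_le_card (R := ℝ) (s.toFinset.image α)
  rw [Finset.coe_image, coe_toFinset, Set.finrank, hs, finrank_top, finrank_fintype_fun_eq_card] at h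
  exact h.trans (Finset.card_image_le.trans (Set.ncard_eq_toFinset_card' s).ge)

/-- Removing an index from a tight set of minimal size leaves a set whose span misses `c`. -/
lemma IsGenericCovector.notMem_span_diff [Finite ι] {α : ι → κ → ℝ} {c : κ → ℝ}
    (hc : IsGenericCovector α c) {s : Set ι} (hs : s.ncard ≤ Fintype.card κ) {i : ι}
    (hi : i ∈ s) : c ∉ Submodule.span ℝ (α '' (s \ {i})) := fun h => by
  have := card_le_ncard_of_span_image_eq_top (hc _ h)
  have := Set.ncard_sdiff_singleton_lt_of_mem hi
  omega

/-- At a simple point, the cell which has it as its minimum is unique. -/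
lemma IsCellMin.index_eq [Finite ι] {α : ι → κ → ℝ} {β : ι → ℝ} {c v : κ → ℝ}
    {k l : ι → ℤ} (hc : IsGenericCovector α c) (hk : IsCellMin α β c k v)
    (hl : IsCellMin α β c l v) (hs : (tightSet α β v).ncard ≤ Fintype.card κ) : k = l := by
  funext i
  have hki := hk.1 i
  have hli := hl.1 i
  by_cases hi : i ∈ tightSet α β v
  · obtain ⟨w, hw, hneg⟩ := exists_dotProduct_neg_of_notMem_span (hc.notMem_span_diff hs hi)
    obtain ⟨z, hz⟩ := hi
    have hj : ∀ j, j ≠ i → ∀ z : ℤ, α j ⬝ᵥ v - β j = z → α j ⬝ᵥ w = 0 := fun j hj z hz =>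
      hw _ (mem_image_of_mem _ ⟨⟨z, hz⟩, hj⟩)
    -- As `w` is orthogonal to the other tight normals and decreases `c`, only wall `i` can block
    -- it; the sign of `αᵢ · w` tells on which side of that wall the cell lies.
    have key : ∀ q : ι → ℤ, IsCellMin α β c q v →
        (α i ⬝ᵥ w < 0 → z = q i) ∧ (0 < α i ⬝ᵥ w → z = q i + 1) ∧ α i ⬝ᵥ w ≠ 0 := by
      intro q hq
      have main : ¬ ((z = q i → 0 ≤ α i ⬝ᵥ w) ∧ (z = q i + 1 → α i ⬝ᵥ w ≤ 0)) := by
        rintro ⟨h0, h1⟩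
        refine hneg.not_ge (hq.dotProduct_nonneg (fun j hjq => ?_) fun j hjq => ?_)
        · rcases eq_or_ne j i with rfl | hne
          · exact h0 (by exact_mod_cast hz.symm.trans hjq)
          · exact (hj j hne _ hjq).ge
        · rcases eq_or_ne j i with rfl | hne
          · exact h1 (by exact_mod_cast hz.symm.trans hjq)
          · exact (hj j hne (q j + 1) (by push_cast; exact hjq)).le
      refine ⟨fun h => ?_, fun h => ?_, fun h => ?_⟩
      · by_contra hne
        exact main ⟨fun h' => absurd h' hne, fun _ => h.le⟩
      · by_contra hne
        exact main ⟨fun _ => h.le, fun h' => absurd h' hne⟩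
      · exact main ⟨fun _ => h.ge, fun _ => h.le⟩
    obtain ⟨a1, a2, a3⟩ := key k hk
    obtain ⟨b1, b2, -⟩ := key l hl
    rcases lt_or_gt_of_ne a3 with h | h
    · rw [← a1 h, ← b1 h]
    · have := a2 h
      have := b2 h
      omega
  · have aux : ∀ q : ι → ℤ, IsCellMin α β c q v → ⌊α i ⬝ᵥ v - β i⌋ = q i := fun q hq => by
      refine Int.floor_eq_iff.2 ⟨(hq.1 i).1, lt_of_le_of_ne (hq.1 i).2 fun h => hi ⟨q i + 1, ?_⟩⟩
      push_cast
      exact h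
    rw [← aux k hk, ← aux l hl]

/-- Every simple point is the minimum of some cell with nonempty interior. -/
lemma exists_isCellMin_of_simple [Fintype ι] {α : ι → κ → ℝ} {β : ι → ℝ} {c v : κ → ℝ}
    (hc : IsGenericCovector α c) (hspan : Submodule.span ℝ (α '' tightSet α β v) = ⊤)
    (hs : (tightSet α β v).ncard ≤ Fintype.card κ) :
    ∃ k, (openCell α β k).Nonempty ∧ IsCellMin α β c k v := by
  classical
  set s := tightSet α β v
  have hcard : Fintype.card s = finrank ℝ (κ → ℝ) := by
    rw [finrank_fintype_fun_eq_card, ← Set.toFinset_card, ← Set.ncard_eq_toFinset_card']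
    exact le_antisymm hs (card_le_ncard_of_span_image_eq_top hspan)
  have hspan' : ⊤ ≤ Submodule.span ℝ (range fun i : s => α i) := by
    rw [← hspan, image_eq_range]
  let b : Basis s ℝ (κ → ℝ) :=
    basisOfTopLeSpanOfCardEqFinrank (fun i : s => α i) hspan' hcard
  have hb : ∀ i : s, b i = α i := fun i => by simp [b]
  have hsum : ∑ i, b.repr c i • α i = c := by
    simpa [hb] using b.sum_repr c
  have hne : ∀ i : s, b.repr c i ≠ 0 := by
    intro i hi
    refine hc.notMem_span_diff hs i.2 ?_
    rw [← hsum]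
    refine Submodule.sum_mem _ fun j _ => ?_
    rcases eq_or_ne j i with rfl | hj
    · simp [hi]
    · exact Submodule.smul_mem _ _ (Submodule.subset_span
        (mem_image_of_mem _ ⟨j.2, fun h => hj (Subtype.ext h)⟩))
  -- Take `αᵢ · w` equal to the `i`-th coordinate of `c`: a small step along `w` enters the desired
  -- cell.
  obtain ⟨w, hw⟩ := (dotProductEquiv ℝ κ).surjective (b.constr ℝ fun i => b.repr c i)
  have hw : ∀ i : s, α i ⬝ᵥ w = b.repr c i := fun i => by
    have := b.constr_basis ℝ (fun i => b.repr c i) i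
    rwa [← hw, dotProductEquiv_apply_apply, dotProduct_comm, hb] at this
  have key : ∀ᶠ ε : ℝ in 𝓝[>] 0, ∀ i,
      (∃ q : ℤ, (q : ℝ) < α i ⬝ᵥ (v + ε • w) - β i ∧ α i ⬝ᵥ (v + ε • w) - β i < q + 1 ∧
        q ≤ α i ⬝ᵥ v - β i ∧ α i ⬝ᵥ v - β i ≤ q + 1 ∧
        ∀ h : i ∈ s, (0 < b.repr c ⟨i, h⟩ → α i ⬝ᵥ v - β i = q) ∧
          (b.repr c ⟨i, h⟩ < 0 → α i ⬝ᵥ v - β i = q + 1)) := by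
    refine eventually_all.2 fun i => ?_
    simp only [dotProduct_add, dotProduct_smul, smul_eq_mul]
    have ht : Tendsto (fun ε : ℝ => α i ⬝ᵥ v + ε * α i ⬝ᵥ w - β i) (𝓝[>] 0)
        (𝓝 (α i ⬝ᵥ v - β i)) := by
      have : Continuous fun ε : ℝ => α i ⬝ᵥ v + ε * α i ⬝ᵥ w - β i := by fun_prop
      simpa using (this.tendsto 0).mono_left nhdsWithin_le_nhds
    by_cases hi : i ∈ s
    · obtain ⟨z, hz⟩ := id hi
      have hwi := hw ⟨i, hi⟩
      rcases lt_or_gt_of_ne (hne ⟨i, hi⟩) with h | h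
      -- A negative coordinate makes `z` the upper wall, so the cell index is `z - 1`.
      · filter_upwards [self_mem_nhdsWithin,
          ht.eventually (lt_mem_nhds (show (z : ℝ) - 1 < _ by rw [hz]; linarith))] with ε hε h1
        refine ⟨z - 1, by push_cast; exact h1, ?_, ?_, ?_, fun _ => ⟨fun h' => ?_, fun _ => ?_⟩⟩
        · push_cast
          nlinarith [mem_Ioi.1 hε]
        · push_cast
          linarith
        · push_cast
          linarith
        · exact absurd h' h.not_gt
        · push_cast
          linarith
      · filter_upwards [self_mem_nhdsWithin,
          ht.eventually (gt_mem_nhds (show _ < (z : ℝ) + 1 by rw [hz]; linarith))] with ε hε h1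
        refine ⟨z, ?_, h1, hz.ge, by linarith, fun _ => ⟨fun _ => hz, fun h' => ?_⟩⟩
        · nlinarith [mem_Ioi.1 hε]
        · exact absurd h' h.not_gt
    · have hlt : (⌊α i ⬝ᵥ v - β i⌋ : ℝ) < α i ⬝ᵥ v - β i :=
        lt_of_le_of_ne (Int.floor_le _) fun h => hi ⟨_, h.symm⟩
      filter_upwards [ht.eventually (lt_mem_nhds hlt),
        ht.eventually (gt_mem_nhds (Int.lt_floor_add_one (α i ⬝ᵥ v - β i)))] with ε h1 h2
      exact ⟨_, h1, h2, hlt.le, (Int.lt_floor_add_one _).le, fun h => absurd h hi⟩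
  obtain ⟨ε, hε⟩ := key.exists
  choose k hk1 hk2 hk3 hk4 hk5 using hε
  refine ⟨k, ⟨_, fun i => ⟨hk1 i, hk2 i⟩⟩, fun i => ⟨hk3 i, hk4 i⟩, fun y hy => ?_⟩
  -- In `c · (y - v)`, expanded in the basis of tight normals, each coordinate has the sign of `αᵢ ·
  -- (y - v)` allowed by the cell.
  rw [← sub_nonneg, ← dotProduct_sub, ← hsum, sum_dotProduct]
  refine Finset.sum_nonneg fun i _ => ?_
  rw [smul_dotProduct, smul_eq_mul, dotProduct_sub]
  obtain ⟨h1, h2⟩ := hk5 i i.2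
  rcases lt_or_gt_of_ne (hne i) with h | h
  · exact mul_nonneg_of_nonpos_of_nonpos h.le (by linarith [h2 h, hy i])
  · exact mul_nonneg h.le (by linarith [h1 h, hy i])

end Cells

/-! ### Lattice quotients, dimension and integral systems on the torus -/

section Torus

variable {κ : Type*}

/-- The projection from Euclidean space to the torus. -/
def torusMk (x : κ → ℝ) : UnitAddTorus κ := fun j => (x j : UnitAddCircle)

lemma torusMk_add (x y : κ → ℝ) : torusMk (x + y) = torusMk x + torusMk y := rfl

lemma torusMk_surjective : Function.Surjective (torusMk (κ := κ)) := by
  intro p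
  choose x hx using fun j => QuotientAddGroup.mk_surjective (p j)
  exact ⟨x, funext hx⟩

lemma continuous_torusMk : Continuous (torusMk (κ := κ)) :=
  continuous_pi fun j => (AddCircle.continuous_mk' 1).comp (continuous_apply j)

lemma isOpenMap_torusMk [Finite κ] : IsOpenMap (torusMk (κ := κ)) :=
  IsOpenMap.piMap (fun _ => QuotientAddGroup.isOpenMap_coe)
    (by simp)

lemma coe_eq_coe_iff_exists_add_int {x y : ℝ} :
    (x : UnitAddCircle) = y ↔ ∃ z : ℤ, y = x + z := by
  rw [eq_comm, ← sub_eq_zero, ← AddCircle.coe_sub, AddCircle.coe_eq_zero_iff]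
  simp only [zsmul_eq_mul, mul_one]
  exact exists_congr fun z => ⟨fun h => by linarith, fun h => by linarith⟩

lemma torusMk_eq_torusMk_iff {x y : κ → ℝ} :
    torusMk x = torusMk y ↔ ∃ z : κ → ℤ, y = x + fun j => (z j : ℝ) := by
  refine ⟨fun h => ?_, ?_⟩
  · choose z hz using fun j => coe_eq_coe_iff_exists_add_int.1 (congrFun h j)
    exact ⟨z, funext hz⟩
  · rintro ⟨z, rfl⟩
    exact funext fun j => coe_eq_coe_iff_exists_add_int.2 ⟨z j, rfl⟩

variable [Fintype κ]

lemma sum_zsmul_torusMk (a : κ → ℤ) (x : κ → ℝ) :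
    ∑ j, a j • torusMk x j = (((fun j => (a j : ℝ)) ⬝ᵥ x : ℝ) : UnitAddCircle) := by
  simp only [torusMk, dotProduct]
  rw [← QuotientAddGroup.mk'_apply, map_sum]
  simp [← zsmul_eq_mul]

lemma sum_zsmul_torusMk_eq_coe_iff (a : κ → ℤ) (x : κ → ℝ) (β : ℝ) :
    ∑ j, a j • torusMk x j = (β : UnitAddCircle) ↔
      ∃ z : ℤ, (fun j => (a j : ℝ)) ⬝ᵥ x - β = z := by
  rw [sum_zsmul_torusMk, eq_comm, coe_eq_coe_iff_exists_add_int]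
  exact exists_congr fun z => ⟨fun h => by linarith, fun h => by linarith⟩

/-- Half of the circle is an isometric copy of an interval. -/
lemma one_le_dimH_univ_unitAddCircle : 1 ≤ dimH (univ : Set UnitAddCircle) := by
  let f : Icc (0 : ℝ) (1 / 2) → UnitAddCircle := fun t => ((t : ℝ) : UnitAddCircle)
  have hf : Isometry f := by
    refine Isometry.of_dist_eq fun s t => ?_
    rw [dist_eq_norm, ← AddCircle.coe_sub, (AddCircle.norm_coe_eq_abs_iff 1 one_ne_zero).2]
    · rfl
    · rw [abs_one, abs_le]
      constructor <;> linarith [s.2.1, s.2.2, t.2.1, t.2.2]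
  calc 1 = dimH (Icc (0 : ℝ) (1 / 2)) := by
        rw [Real.dimH_of_nonempty_interior (by simp)]
        simp
    _ = dimH (range f) := by
        rw [← image_univ, hf.dimH_image,
          ← (isometry_subtype_coe (s := Icc (0 : ℝ) (1 / 2))).dimH_image, image_univ,
          Subtype.range_coe]
    _ ≤ _ := dimH_mono (subset_univ _)

/-- A subset of the torus which contains the image of a line has positive dimension. -/
lemma one_le_dimH_of_line_subset {s : Set (UnitAddTorus κ)} {p : UnitAddTorus κ} {w : κ → ℝ}
    (hw : w ≠ 0) (hs : ∀ t : ℝ, p + torusMk (t • w) ∈ s) : 1 ≤ dimH s := by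
  obtain ⟨j, hj⟩ := Function.ne_iff.1 hw
  -- A coordinate with `w j ≠ 0` carries the line onto the whole circle, and projections are
  -- Lipschitz.
  have himg : (Function.eval j) '' s = univ := by
    refine eq_univ_of_forall fun y => ?_
    obtain ⟨r, hr⟩ := QuotientAddGroup.mk_surjective (y - p j)
    refine ⟨_, hs (r / w j), ?_⟩
    have h : (r / w j) * w j = r := div_mul_cancel₀ _ hj
    have h' : torusMk ((r / w j) • w) j = ((r : ℝ) : UnitAddCircle) := by
      simp [torusMk, h]
    simp only [Function.eval, Pi.add_apply, h']
    rw [show (r : UnitAddCircle) = y - p j from hr]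
    abel
  calc 1 ≤ dimH (univ : Set UnitAddCircle) := one_le_dimH_univ_unitAddCircle
    _ = dimH ((Function.eval j) '' s) := by rw [himg]
    _ ≤ dimH s := (LipschitzWith.eval j).dimH_image_le s

variable [DecidableEq κ]

/-- The index of the lattice spanned by the columns of a nonsingular integer matrix. -/
lemma index_range_mulVecLin (M : Matrix κ κ ℤ) (hM : M.det ≠ 0) :
    (LinearMap.range M.mulVecLin).toAddSubgroup.index = M.det.natAbs := by
  have hinj : Function.Injective M.mulVecLin := Matrix.mulVec_injective_of_det_ne_zero hM
  have h := Submodule.natAbs_det_equiv (LinearMap.range M.mulVecLin)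
    (LinearEquiv.ofInjective M.mulVecLin hinj)
  rw [AddSubgroup.index, ← LinearMap.det_toLin' M]
  exact h.symm

/-- The number of solutions on the torus of a nonsingular square integral linear system. -/
lemma card_solutions_torus (M : Matrix κ κ ℤ) (hM : M.det ≠ 0) (b : κ → UnitAddCircle) :
    Nat.card {p : UnitAddTorus κ // ∀ i, ∑ j, M i j • p j = b i} = M.det.natAbs := by
  set R : Matrix κ κ ℝ := M.map (Int.castRingHom ℝ) with hR
  have hdet : IsUnit R.det := by
    rw [hR, ← RingHom.mapMatrix_apply, ← RingHom.map_det]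
    simpa using hM
  have hcast : ∀ z : κ → ℤ, R.mulVec (fun j => (z j : ℝ)) = fun i => (M.mulVec z i : ℝ) := by
    intro z
    ext i
    simp [hR, Matrix.mulVec, dotProduct]
  have hrow : ∀ i, R i = fun j => (M i j : ℝ) := fun i => rfl
  -- The map `z ↦ M⁻¹ z` has kernel `M ℤⁿ` and image the homogeneous solutions, so these number the
  -- index of `M ℤⁿ`.
  let h : (κ → ℤ) →+ UnitAddTorus κ :=
    { toFun := fun z => torusMk (R⁻¹.mulVec fun j => (z j : ℝ))
      map_zero' := by
        funext j
        simp [torusMk, Matrix.mulVec, dotProduct]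
      map_add' := fun x y => by
        rw [← torusMk_add, ← Matrix.mulVec_add]
        congr
        ext j
        simp }
  have hker : h.ker = (LinearMap.range M.mulVecLin).toAddSubgroup := by
    ext z
    have h0 : (0 : UnitAddTorus κ) = torusMk 0 := rfl
    rw [AddMonoidHom.mem_ker, Submodule.mem_toAddSubgroup, LinearMap.mem_range, h0, eq_comm]
    change torusMk 0 = torusMk _ ↔ _
    rw [torusMk_eq_torusMk_iff]
    refine exists_congr fun y => ?_
    rw [zero_add, Matrix.mulVecLin_apply]
    constructor
    · intro e
      have e' := congrArg R.mulVec e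
      rw [Matrix.mulVec_mulVec, Matrix.mul_nonsing_inv _ hdet, Matrix.one_mulVec, hcast] at e'
      funext i
      exact_mod_cast (congrFun e' i).symm
    · rintro rfl
      rw [← hcast, Matrix.mulVec_mulVec, Matrix.nonsing_inv_mul _ hdet, Matrix.one_mulVec]
  have hrange : ∀ p, p ∈ h.range ↔ ∀ i, ∑ j, M i j • p j = 0 := by
    intro p
    constructor
    · rintro ⟨z, rfl⟩ i
      change ∑ j, M i j • torusMk _ j = ((0 : ℝ) : UnitAddCircle)
      rw [sum_zsmul_torusMk_eq_coe_iff]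
      refine ⟨z i, ?_⟩
      have : R.mulVec (R⁻¹.mulVec fun j => (z j : ℝ)) i = z i := by
        rw [Matrix.mulVec_mulVec, Matrix.mul_nonsing_inv _ hdet, Matrix.one_mulVec]
      rw [sub_zero]
      exact this
    · intro hp
      obtain ⟨x, rfl⟩ := torusMk_surjective p
      choose z hz using fun i => (sum_zsmul_torusMk_eq_coe_iff (M i) x 0).1 (hp i)
      refine ⟨z, ?_⟩
      have e : (fun i => (z i : ℝ)) = R.mulVec x := by
        ext i
        rw [← hz i, sub_zero]
        rfl
      change torusMk _ = _
      rw [e, Matrix.mulVec_mulVec, Matrix.nonsing_inv_mul _ hdet, Matrix.one_mulVec]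
  obtain ⟨p₀, hp₀⟩ : ∃ p : UnitAddTorus κ, ∀ i, ∑ j, M i j • p j = b i := by
    obtain ⟨β, rfl⟩ := torusMk_surjective b
    refine ⟨torusMk (R⁻¹.mulVec β), fun i => ?_⟩
    rw [sum_zsmul_torusMk]
    change ((R.mulVec (R⁻¹.mulVec β) i : ℝ) : UnitAddCircle) = _
    rw [Matrix.mulVec_mulVec, Matrix.mul_nonsing_inv _ hdet, Matrix.one_mulVec]
    rfl
  have e : {p : UnitAddTorus κ // ∀ i, ∑ j, M i j • p j = b i} ≃ h.range :=
    (Equiv.subRight p₀).subtypeEquiv fun p => by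
      rw [hrange]
      simp only [Equiv.subRight_apply, Pi.sub_apply, zsmul_sub, Finset.sum_sub_distrib, hp₀,
        sub_eq_zero]
  rw [Nat.card_congr e, ← AddSubgroup.index_ker, hker, index_range_mulVecLin M hM]

end Torus

/-! ### Cells under integer translations -/

section Translation

variable {ι κ : Type*} [Fintype κ] {α : ι → κ → ℝ} {β : ι → ℝ} {t : κ → ℝ} {l : ι → ℤ}

lemma add_mem_openCell (ht : ∀ i, α i ⬝ᵥ t = l i) {k : ι → ℤ} {x : κ → ℝ}
    (hx : x ∈ openCell α β k) : x + t ∈ openCell α β (k + l) := by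
  intro i
  simp only [dotProduct_add, ht, Pi.add_apply, Int.cast_add]
  constructor <;> linarith [hx i]

lemma add_mem_closedCell (ht : ∀ i, α i ⬝ᵥ t = l i) {k : ι → ℤ} {x : κ → ℝ}
    (hx : x ∈ closedCell α β k) : x + t ∈ closedCell α β (k + l) := by
  intro i
  simp only [dotProduct_add, ht, Pi.add_apply, Int.cast_add]
  constructor <;> linarith [hx i]

lemma IsCellMin.add {c v : κ → ℝ} {k : ι → ℤ} (hv : IsCellMin α β c k v)
    (ht : ∀ i, α i ⬝ᵥ t = l i) : IsCellMin α β c (k + l) (v + t) := by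
  refine ⟨add_mem_closedCell ht hv.1, fun y hy => ?_⟩
  have ht' : ∀ i, α i ⬝ᵥ (-t) = (-l) i := fun i => by simp [ht]
  have h := add_mem_closedCell ht' hy
  rw [add_neg_cancel_right] at h
  have := hv.2 _ h
  simp only [dotProduct_add, dotProduct_neg] at this ⊢
  linarith

lemma openCell_index_unique {k l : ι → ℤ} {x : κ → ℝ} (hk : x ∈ openCell α β k)
    (hl : x ∈ openCell α β l) : k = l := by
  funext i
  rw [← Int.floor_eq_iff.2 ⟨(hk i).1.le, (hk i).2⟩, Int.floor_eq_iff.2 ⟨(hl i).1.le, (hl i).2⟩]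

end Translation

/-- A function which is constant precisely on the connected components has a range in bijection
with the set of components. -/
lemma nonempty_connectedComponents_equiv_range {X Y : Type*} [TopologicalSpace X] (f : X → Y)
    (hf : ∀ p q : X, (p : ConnectedComponents X) = q ↔ f p = f q) :
    Nonempty (ConnectedComponents X ≃ range f) := by
  refine ⟨Equiv.ofBijective
    (Quotient.lift (fun p => (⟨f p, mem_range_self p⟩ : range f))
      fun p q h => Subtype.ext ((hf p q).1 (Quotient.sound h))) ⟨?_, ?_⟩⟩
  · intro x y
    induction x using Quotient.inductionOn
    induction y using Quotient.inductionOn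
    intro h
    exact (hf _ _).2 (congrArg Subtype.val h)
  · rintro ⟨_, p, rfl⟩
    exact ⟨Quotient.mk _ p, rfl⟩

/-! ### Regions and vertices on the torus -/

section Periodic

variable {ι κ : Type*} [Fintype ι] [Fintype κ]

/-- The regions of a spanning simple toric arrangement are in bijection with its vertices. -/
theorem nonempty_regions_equiv_vertices (a : ι → κ → ℤ) (β : ι → ℝ) {α : ι → κ → ℝ}
    (hα : ∀ i j, α i j = a i j) (H : ι → Set (UnitAddTorus κ))
    (hH : ∀ i x, torusMk x ∈ H i ↔ i ∈ tightSet α β x)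
    (hspan : Submodule.span ℝ (range α) = ⊤)
    (hsimple : ∀ v, (tightSet α β v).ncard ≤ Fintype.card κ) :
    Nonempty (ConnectedComponents ((⋃ i, H i)ᶜ : Set (UnitAddTorus κ)) ≃
      {v | Submodule.span ℝ (α '' tightSet α β v) = ⊤}.image torusMk) := by
  obtain ⟨c, hc⟩ := exists_isGenericCovector α
  have htrans : ∀ z : κ → ℤ, ∃ l : ι → ℤ, ∀ i, α i ⬝ᵥ (fun j => (z j : ℝ)) = l i := by
    intro z
    refine ⟨fun i => ∑ j, a i j * z j, fun i => ?_⟩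
    simp [dotProduct, hα]
  have hcompl : ∀ x, torusMk x ∈ (⋃ i, H i)ᶜ ↔ tightSet α β x = ∅ := by
    intro x
    simp only [mem_compl_iff, mem_iUnion, hH, not_exists, eq_empty_iff_forall_notMem]
  have hex : ∀ p : ((⋃ i, H i)ᶜ : Set (UnitAddTorus κ)), ∃ x k v,
      torusMk x = p.1 ∧ x ∈ openCell α β k ∧ IsCellMin α β c k v := by
    rintro ⟨p, hp⟩
    obtain ⟨x, rfl⟩ := torusMk_surjective p
    have hx := mem_openCell_floor ((hcompl x).1 hp)
    obtain ⟨v, hv⟩ := exists_isCellMin hspan β c ⟨x, hx⟩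
    exact ⟨x, _, v, rfl, hx, hv⟩
  choose X K V hX hK hV using hex
  -- On the torus the vertex does not depend on the chosen lift, since lifts differ by integer
  -- translations.
  have hwell : ∀ p x k v, torusMk x = p.1 → x ∈ openCell α β k → IsCellMin α β c k v →
      torusMk (V p) = torusMk v := by
    intro p x k v hx hk hv
    obtain ⟨z, hz⟩ := torusMk_eq_torusMk_iff.1 ((hX p).trans hx.symm)
    obtain ⟨l, hl⟩ := htrans z
    obtain rfl : K p + l = k := openCell_index_unique (add_mem_openCell hl (hK p)) (hz ▸ hk)
    exact torusMk_eq_torusMk_iff.2 ⟨z, hv.eq hc ((hV p).add hl)⟩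
  have hloc : IsLocallyConstant fun p => torusMk (V p) := by
    refine (IsLocallyConstant.iff_eventually_eq _).2 fun p => ?_
    have hopen := isOpenMap_torusMk _ (isOpen_openCell α β (K p))
    have hmem : p.1 ∈ torusMk '' openCell α β (K p) := ⟨X p, hK p, hX p⟩
    filter_upwards [continuous_subtype_val.continuousAt.preimage_mem_nhds (hopen.mem_nhds hmem)]
    rintro q ⟨y, hy, hyq⟩
    exact hwell q y _ _ hyq hy (hV p)
  have hcomp : ∀ p q : ((⋃ i, H i)ᶜ : Set (UnitAddTorus κ)),
      (p : ConnectedComponents ((⋃ i, H i)ᶜ : Set (UnitAddTorus κ))) = q ↔ torusMk (V p) = torusMk (V q) := by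
    intro p q
    rw [ConnectedComponents.coe_eq_coe']
    constructor
    · intro h
      exact hloc.apply_eq_of_isPreconnected isPreconnected_connectedComponent h
        mem_connectedComponent
    · intro h
      obtain ⟨z, hz⟩ := torusMk_eq_torusMk_iff.1 h
      obtain ⟨l, hl⟩ := htrans z
      -- Two regions with the same vertex have lifts in the same cell up to translation, and the
      -- image of a convex cell is connected.
      have hk : K p + l = K q := ((hV p).add hl).index_eq hc (hz ▸ hV q) (hsimple _)
      have hpq : torusMk '' openCell α β (K q) ⊆ (⋃ i, H i)ᶜ := by
        rintro _ ⟨y, hy, rfl⟩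
        exact (hcompl y).2 (tightSet_eq_empty_of_mem_openCell hy)
      have hconn : IsPreconnected (Subtype.val ⁻¹' (torusMk '' openCell α β (K q)) :
          Set ((⋃ i, H i)ᶜ : Set (UnitAddTorus κ))) := by
        refine IsInducing.subtypeVal.isPreconnected_image.1 ?_
        rw [Subtype.image_preimage_coe, inter_eq_right.2 hpq]
        exact (convex_openCell α β _).isPreconnected.image _ continuous_torusMk.continuousOn
      refine hconn.subset_connectedComponent ⟨X q, hK q, hX q⟩
        ⟨X p + fun j => (z j : ℝ), hk ▸ add_mem_openCell hl (hK p), ?_⟩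
      rw [← hX p]
      exact (torusMk_eq_torusMk_iff.2 ⟨z, rfl⟩).symm
  obtain ⟨e⟩ := nonempty_connectedComponents_equiv_range _ hcomp
  refine ⟨e.trans (Equiv.setCongr (Subset.antisymm ?_ ?_))⟩
  · rintro _ ⟨p, rfl⟩
    exact ⟨V p, (hV p).span_tightSet hc, rfl⟩
  · rintro _ ⟨v, hv, rfl⟩
    obtain ⟨k, ⟨x, hx⟩, hmin⟩ := exists_isCellMin_of_simple hc hv (hsimple v)
    exact ⟨⟨torusMk x, (hcompl x).2 (tightSet_eq_empty_of_mem_openCell hx)⟩,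
      hwell _ x k v rfl hx hmin⟩

end Periodic

/-! ### General position and counting vertices -/

namespace ToricArrangement

variable {n m : ℕ} {A : ToricArrangement n m} {a : Fin m → Fin n → ℤ}

/-- The points common to the hyperplanes indexed by `S` solve a square integral linear system. -/
lemma mem_iInter_iff {b : Fin m → UnitAddCircle}
    (hb : ∀ i p, p ∈ A.hyperplane i ↔ ∑ j, a i j • p j = b i)
    (S : {S : Finset (Fin m) // S.card = n}) (p : UnitAddTorus (Fin n)) :
    p ∈ ⋂ i ∈ S.1, A.hyperplane i ↔
      ∀ r, ∑ j, (normalMatrix a S).transpose r j • p j = b (S.1.orderEmbOfFin S.2 r) := by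
  simp only [mem_iInter, hb, normalMatrix, Matrix.transpose_apply, Matrix.of_apply]
  refine ⟨fun h r => h _ (Finset.orderEmbOfFin_mem S.1 S.2 r), fun h i hi => ?_⟩
  obtain ⟨r, rfl⟩ : i ∈ range (S.1.orderEmbOfFin S.2) := by
    rw [Finset.range_orderEmbOfFin]
    exact hi
  exact h r

/-- In general position, hyperplanes with a common point have independent normal vectors. -/
lemma InGeneralPosition.det_ne_zero (hgen : A.InGeneralPosition) {b : Fin m → UnitAddCircle}
    (hb : ∀ i p, p ∈ A.hyperplane i ↔ ∑ j, a i j • p j = b i)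
    {S : {S : Finset (Fin m) // S.card = n}} (hS : (⋂ i ∈ S.1, A.hyperplane i).Nonempty) :
    (normalMatrix a S).det ≠ 0 := by
  intro hdet
  rw [← Matrix.det_transpose] at hdet
  obtain ⟨w, hw, hMw⟩ := Matrix.exists_mulVec_eq_zero_iff.2 hdet
  obtain ⟨p, hp⟩ := hS
  have hw' : (fun j => (w j : ℝ)) ≠ 0 := fun h => hw (funext fun j => by
    simpa using congrFun h j)
  have h1 : 1 ≤ dimH (⋂ i ∈ S.1, A.hyperplane i) := by
    refine one_le_dimH_of_line_subset (p := p) hw' fun t => ?_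
    rw [mem_iInter_iff hb] at hp ⊢
    intro r
    simp only [Pi.add_apply, zsmul_add, Finset.sum_add_distrib, hp r, add_eq_left]
    rw [sum_zsmul_torusMk]
    have : (fun j => ((normalMatrix a S).transpose r j : ℝ)) ⬝ᵥ (fun j => (w j : ℝ)) = 0 := by
      have := congrFun hMw r
      simp only [Matrix.mulVec, dotProduct, Pi.zero_apply] at this ⊢
      exact_mod_cast this
    rw [dotProduct_smul, this, smul_zero]
    rfl
  have h0 := hgen.1 S.1 S.2.le
  rw [S.2, Nat.sub_self, Nat.cast_zero] at h0
  exact absurd (h1.trans h0) (by simp)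

/-- The rows indexed by `S` span the space if the corresponding determinant does not vanish. -/
lemma span_image_eq_top {α : Fin m → Fin n → ℝ} (hα : ∀ i j, α i j = a i j)
    {S : {S : Finset (Fin m) // S.card = n}} (hS : (normalMatrix a S).det ≠ 0)
    {s : Set (Fin m)} (hs : (S.1 : Set (Fin m)) ⊆ s) : Submodule.span ℝ (α '' s) = ⊤ := by
  refine (Submodule.eq_top_iff').2 fun c => ?_
  by_contra hc
  -- A nonzero `w` orthogonal to the rows would lie in the kernel of the transposed normal matrix.
  obtain ⟨w, hw, hneg⟩ := exists_dotProduct_neg_of_notMem_span hc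
  have hw0 : w ≠ 0 := by
    rintro rfl
    simp at hneg
  refine hS ?_
  have h : ((normalMatrix a S).transpose.map (Int.castRingHom ℝ)).det = 0 := by
    refine Matrix.exists_mulVec_eq_zero_iff.1 ⟨w, hw0, funext fun r => ?_⟩
    have := hw _ (mem_image_of_mem α (hs (Finset.orderEmbOfFin_mem S.1 S.2 r)))
    simpa [Matrix.mulVec, dotProduct, normalMatrix, hα] using this
  rw [← RingHom.mapMatrix_apply, ← RingHom.map_det, Matrix.det_transpose] at h
  simpa using h

end ToricArrangement

theorem mainTheorem3 (n m : ℕ) (hnm : n < m) (A : ToricArrangement n m)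
    (hgen : A.InGeneralPosition) (hspan : A.IsSpanning)
    (a : Fin m → Fin n → ℤ) (ha : ∀ i, IsNormalVector (a i) (A.hyperplane i)) :
    Finite A.TopFlats ∧
      (Nat.card A.TopFlats : ℤ) =
        ∑ S : {S : Finset (Fin m) // S.card = n}, |(normalMatrix a S).det| := by
  classical
  choose θ b hθ hθa hA using ha
  have hb : ∀ i p, p ∈ A.hyperplane i ↔ ∑ j, a i j • p j = b i := fun i p => by
    rw [hA, ← hθa]
    rfl
  obtain ⟨β, rfl⟩ := torusMk_surjective b
  let α : Fin m → Fin n → ℝ := fun i j => a i j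
  have hH : ∀ i x, torusMk x ∈ A.hyperplane i ↔ i ∈ tightSet α β x := fun i x => by
    rw [hb]
    exact sum_zsmul_torusMk_eq_coe_iff (a i) x (β i)
  have hmem : ∀ (S : Finset (Fin m)) x,
      torusMk x ∈ ⋂ i ∈ S, A.hyperplane i ↔ (S : Set (Fin m)) ⊆ tightSet α β x := fun S x => by
    simp only [mem_iInter, hH]
    rfl
  have hsimple : ∀ v, (tightSet α β v).ncard ≤ n := fun v => by
    by_contra! h
    rw [Set.ncard_eq_toFinset_card'] at h
    have := (hmem (tightSet α β v).toFinset v).2 (by simp)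
    rw [hgen.2 _ h] at this
    exact this
  have hspanα : Submodule.span ℝ (range α) = ⊤ := by
    obtain ⟨S, hS, hne⟩ := hspan
    rw [← image_univ]
    exact ToricArrangement.span_image_eq_top (S := ⟨S, hS⟩) (fun _ _ => rfl)
      (hgen.det_ne_zero hb hne) (subset_univ _)
  obtain ⟨e⟩ := nonempty_regions_equiv_vertices a β (fun _ _ => rfl) A.hyperplane hH hspanα
    (by simpa using hsimple)
  let P : {S : Finset (Fin m) // S.card = n} → Set (UnitAddTorus (Fin n)) :=
    fun S => ⋂ i ∈ S.1, A.hyperplane i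
  have hP : ∀ S, Nat.card (P S) = (normalMatrix a S).det.natAbs ∧ Finite (P S) := fun S => by
    rcases (P S).eq_empty_or_nonempty with h | h
    · rw [h]
      refine ⟨?_, inferInstance⟩
      rw [Nat.card_of_isEmpty, eq_comm, Int.natAbs_eq_zero]
      -- With a nonzero determinant, the system would have a positive number of solutions.
      by_contra hdet
      rw [← Matrix.det_transpose] at hdet
      have hcard := card_solutions_torus _ hdet
        fun r => torusMk β (S.1.orderEmbOfFin S.2 r)
      have : IsEmpty {p : UnitAddTorus (Fin n) // ∀ r,
          ∑ j, (normalMatrix a S).transpose r j • p j =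
            torusMk β (S.1.orderEmbOfFin S.2 r)} := by
        refine ⟨fun p => ?_⟩
        have := (ToricArrangement.mem_iInter_iff hb S p.1).2 p.2
        exact h.le this
      rw [Nat.card_of_isEmpty, eq_comm, Int.natAbs_eq_zero] at hcard
      exact hdet hcard
    · have hdet := hgen.det_ne_zero hb h
      have hcard : Nat.card (P S) = (normalMatrix a S).det.natAbs := by
        rw [← Matrix.det_transpose] at hdet ⊢
        rw [← card_solutions_torus _ hdet fun r => torusMk β (S.1.orderEmbOfFin S.2 r)]
        exact Nat.card_congr (Equiv.subtypeEquivRight fun p =>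
          ToricArrangement.mem_iInter_iff hb S p)
      exact ⟨hcard, Nat.finite_of_card_ne_zero (by rw [hcard]; simpa using hdet)⟩
  have hunion : torusMk '' {v | Submodule.span ℝ (α '' tightSet α β v) = ⊤} = ⋃ S, P S := by
    refine Subset.antisymm ?_ (iUnion_subset fun S p hp => ?_)
    · rintro _ ⟨v, hv, rfl⟩
      have hcard : (tightSet α β v).toFinset.card = n := by
        rw [← Set.ncard_eq_toFinset_card']
        exact le_antisymm (hsimple v) (by simpa using card_le_ncard_of_span_image_eq_top hv)
      exact mem_iUnion.2 ⟨⟨_, hcard⟩, (hmem _ v).2 (by simp)⟩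
    · obtain ⟨v, rfl⟩ := torusMk_surjective p
      exact ⟨v, ToricArrangement.span_image_eq_top (fun _ _ => rfl)
        (hgen.det_ne_zero hb ⟨_, hp⟩) ((hmem _ v).1 hp), rfl⟩
  -- A point common to `n` hyperplanes lies on no other, so `S` is its full tight set.
  have hdisj : Pairwise (Function.onFun Disjoint P) := fun S T hST => by
    refine Set.disjoint_left.2 fun p hpS hpT => hST ?_
    obtain ⟨v, rfl⟩ := torusMk_surjective p
    have key : ∀ U, torusMk v ∈ P U → (U.1 : Set (Fin m)) = tightSet α β v := fun U hU =>
      Set.eq_of_subset_of_ncard_le ((hmem _ v).1 hU)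
        (by rw [Set.ncard_coe_finset, U.2]; exact hsimple v)
    exact Subtype.ext (Finset.coe_injective ((key S hpS).trans (key T hpT).symm))
  have : ∀ S, Finite (P S) := fun S => (hP S).2
  let e' : A.TopFlats ≃ Σ S, P S :=
    (e.trans (Equiv.setCongr hunion)).trans (Set.unionEqSigmaOfDisjoint hdisj)
  refine ⟨Finite.of_equiv _ e'.symm, ?_⟩
  rw [Nat.card_congr e', Nat.card_sigma]
  push_cast
  exact Finset.sum_congr rfl fun S _ => by rw [(hP S).1, Int.natCast_natAbs]
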